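/- Let $L$ be any frame with top $1$ and bottom $0$; for $a\in L$ let $a^*$ be the pseudocomplement of $a$, and call $a$ complemented if $a\vee a^*=1$. Let $\mathcal{R}L$ be the commutative ring of frame homomorphisms $\alpha:\mathfrak{O}\mathbb{R}\to L$ from the frame of reals (the frame of open subsets of $\mathbb{R}$), with operations $$(\alpha\diamond\beta)(U)=\bigvee\{\alpha(V)\wedge\beta(W) : V,W\subseteq\mathbb{R}\text{ open},\ x\diamond y\in U\text{ for all }x\in V,\ y\in W\}\qquad(\diamond\in\{+,\cdot\}).$$ For $r\in\mathbb{R}$ let $\mathbf r\in\mathcal{R}L$ be the constant function ($\mathbf r(U)=1$ if $r\in U$, and $0$ otherwise). Write $\alpha(-,r)=\alpha((-\infty,r))$, $\alpha(r,-)=\alpha((r,\infty))$, $\operatorname{coz}\alpha=\alpha(-,0)\vee\alpha(0,-)$ and $R_\alpha=\{r\in\mathbb{R}: \operatorname{coz}(\alpha-\mathbf r)\neq1\}$. Put $$\mathcal{R}_cL=\{\alpha\in\mathcal{R}L: R_\alpha\text{ is countable}\},\qquad \mathcal{R}_c^*L=\{\alpha\in\mathcal{R}_cL: \alpha((p,q))=1\text{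 for some }p,q\in\mathbb{R}\}.$$ For a complemented $c\in L$ let $e_c\in\mathcal{R}L$ be the function with value $1$ on $c$ and $0$ on $c^*$, that is, $e_c(U)$ is the join of $c$ (included if $1\in U$) and $c^*$ (included if $0\in U$). Let $S$ be $\mathcal{R}_cL$ or $\mathcal{R}_c^*L$. Then $S$ is clean: every $\alpha\in S$ can be written as $\alpha=u+e$ with $u,e\in S$, $e^2=e$, and $uv=\mathbf 1$ for some $v\in S$. In particular, whenever $S$ is a subring of $\mathcal{R}L$, it is a clean ring (every element is the sum of a unit and an idempotent). More precisely, for every $\alpha\in S$: 1. there is a real $r$ with $0<r<\tfrac12$ and $\operatorname{coz}(\alpha-\mathbf r)=1$; 2. for every such $r$, the element $c=\alpha(-,r)$ is complemented, $e_c$ is an idempotent belonging to $S$, and $\alpha-e_c$ is an element of $S$ with an inverse in $S$. -/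

import Mathlib

open TopologicalSpace

noncomputable section

namespace PointfreeReal

/-- Continuous real-valued functions on a frame `L`: frame homomorphisms (maps preserving finite
meets and arbitrary joins) from the frame of reals, i.e. the frame of open subsets of the real
line, to `L`. -/
abbrev RL (L : Type*) [Order.Frame L] := FrameHom (Opens ℝ) L

/-- The element `(-, r)` of the frame of reals. -/
def below (r : ℝ) : Opens ℝ := ⟨Set.Iio r, isOpen_Iio⟩

/-- The element `(r, -)` of the frame of reals. -/
def above (r : ℝ) : Opens ℝ := ⟨Set.Ioi r, isOpen_Ioi⟩

/-- The element `(p, q)` of the frame of reals. -/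
def interval (p q : ℝ) : Opens ℝ := ⟨Set.Ioo p q, isOpen_Ioo⟩

section Pairing

variable {X Y Z L : Type*} [TopologicalSpace X] [TopologicalSpace Y] [TopologicalSpace Z]
  [Order.Frame L]

/-- The open box `V × W`. -/
def box (V : Opens X) (W : Opens Y) : Opens (X × Y) := ⟨(V : Set X) ×ˢ (W : Set Y), V.2.prod W.2⟩

/-- The value on an open `U ⊆ X × Y` of the pairing of `α` and `β`: the join of all
`α V ⊓ β W` over the open boxes `V × W ⊆ U`. -/
def pairFun (α : FrameHom (Opens X) L) (β : FrameHom (Opens Y) L) (U : Opens (X × Y)) : L :=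
  ⨆ (V : Opens X) (W : Opens Y) (_ : box V W ≤ U), α V ⊓ β W

theorem le_pairFun (α : FrameHom (Opens X) L) (β : FrameHom (Opens Y) L) {U : Opens (X × Y)}
    {V : Opens X} {W : Opens Y} (h : box V W ≤ U) : α V ⊓ β W ≤ pairFun α β U :=
  le_iSup_of_le V (le_iSup_of_le W (le_iSup_of_le h le_rfl))

theorem pairFun_le (α : FrameHom (Opens X) L) (β : FrameHom (Opens Y) L) {U : Opens (X × Y)}
    {c : L} (h : ∀ V W, box V W ≤ U → α V ⊓ β W ≤ c) : pairFun α β U ≤ c :=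
  iSup_le fun V => iSup_le fun W => iSup_le fun hVW => h V W hVW

theorem pairFun_mono (α : FrameHom (Opens X) L) (β : FrameHom (Opens Y) L) :
    Monotone (pairFun α β) := fun _ _ hU =>
  pairFun_le α β fun _ _ h => le_pairFun α β (h.trans hU)

theorem exists_box {U : Opens (X × Y)} {x : X} {y : Y} (h : (x, y) ∈ U) :
    ∃ (A : Opens X) (B : Opens Y), x ∈ A ∧ y ∈ B ∧ box A B ≤ U := by
  obtain ⟨u, v, hu, hv, hx, hy, huv⟩ := isOpen_prod_iff.1 U.2 x y h
  exact ⟨⟨u, hu⟩, ⟨v, hv⟩, hx, hy, huv⟩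

theorem pairFun_inf (α : FrameHom (Opens X) L) (β : FrameHom (Opens Y) L)
    (U U' : Opens (X × Y)) : pairFun α β (U ⊓ U') = pairFun α β U ⊓ pairFun α β U' := by
  apply le_antisymm
  · exact le_inf (pairFun_mono α β inf_le_left) (pairFun_mono α β inf_le_right)
  · rw [← le_himp_iff]
    refine pairFun_le α β fun V W h => ?_
    rw [le_himp_iff, inf_comm, ← le_himp_iff]
    refine pairFun_le α β fun V' W' h' => ?_
    rw [le_himp_iff]
    have : α V' ⊓ β W' ⊓ (α V ⊓ β W) = α (V' ⊓ V) ⊓ β (W' ⊓ W) := by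
      rw [map_inf, map_inf, inf_inf_inf_comm]
    rw [this]
    refine le_pairFun α β fun p hp => ?_
    exact ⟨h ⟨hp.1.2, hp.2.2⟩, h' ⟨hp.1.1, hp.2.1⟩⟩

theorem pairFun_sSup [LocallyCompactSpace X] (α : FrameHom (Opens X) L)
    (β : FrameHom (Opens Y) L) (S : Set (Opens (X × Y))) :
    pairFun α β (sSup S) = sSup (pairFun α β '' S) := by
  apply le_antisymm
  · refine pairFun_le α β fun V W h => ?_
    set R := sSup (pairFun α β '' S) with hR
    -- For a compact `K ⊆ V` and a point `y` of `W` there is a good box around `K × {y}`.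
    have key : ∀ y ∈ W, ∀ K : Set X, IsCompact K → K ⊆ V → ∃ A : Opens X, K ⊆ A ∧
        ∃ B : Opens Y, y ∈ B ∧ α A ⊓ β B ≤ R := by
      intro y hy K hK hKV
      refine hK.induction_on (p := fun K => ∃ A : Opens X, K ⊆ A ∧
        ∃ B : Opens Y, y ∈ B ∧ α A ⊓ β B ≤ R) ?_ ?_ ?_ ?_
      · exact ⟨⊥, by simp, ⊤, trivial, by simp⟩
      · rintro s t hst ⟨A, hA, hB⟩
        exact ⟨A, hst.trans hA, hB⟩
      · rintro s t ⟨A, hA, B, hy, hB⟩ ⟨A', hA', B', hy', hB'⟩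
        refine ⟨A ⊔ A', ?_, B ⊓ B', ⟨hy, hy'⟩, ?_⟩
        · exact Set.union_subset_union hA hA'
        · rw [map_sup, inf_sup_right]
          refine sup_le (le_trans ?_ hB) (le_trans ?_ hB')
          · exact inf_le_inf le_rfl (OrderHomClass.mono β inf_le_left)
          · exact inf_le_inf le_rfl (OrderHomClass.mono β inf_le_right)
      · intro x hx
        have hxy : (x, y) ∈ sSup S := h ⟨hKV hx, hy⟩
        obtain ⟨U, hU, hxU⟩ := Opens.mem_sSup.1 hxy
        obtain ⟨A, B, hxA, hyB, hAB⟩ := exists_box hxU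
        exact ⟨A, mem_nhdsWithin_of_mem_nhds (A.2.mem_nhds hxA), A, subset_rfl, B, hyB,
          (le_pairFun α β hAB).trans (le_sSup ⟨U, hU, rfl⟩)⟩
    have key2 : ∀ (V' : Opens X) (K : Set X), IsCompact K → (V' : Set X) ⊆ K → K ⊆ V →
        α V' ⊓ β W ≤ R := by
      intro V' K hK hV' hKV
      have hW : W ≤ sSup {B | α V' ⊓ β B ≤ R} := by
        intro y hy
        obtain ⟨A, hA, B, hyB, hAB⟩ := key y hy K hK hKV
        refine Opens.mem_sSup.2 ⟨B, le_trans (inf_le_inf ?_ le_rfl) hAB, hyB⟩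
        exact OrderHomClass.mono α (show V' ≤ A from hV'.trans hA)
      refine (inf_le_inf le_rfl (OrderHomClass.mono β hW)).trans ?_
      rw [map_sSup, inf_sSup_eq]
      refine iSup₂_le ?_
      rintro _ ⟨B, hB, rfl⟩
      exact hB
    have hV : V ≤ sSup {V' | α V' ⊓ β W ≤ R} := by
      intro x hx
      obtain ⟨K, hK, hxK, hKV⟩ := exists_compact_subset V.2 hx
      exact Opens.mem_sSup.2 ⟨⟨interior K, isOpen_interior⟩,
        key2 _ K hK interior_subset hKV, hxK⟩
    refine (inf_le_inf (OrderHomClass.mono α hV) le_rfl).trans ?_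
    rw [map_sSup, sSup_inf_eq]
    refine iSup₂_le ?_
    rintro _ ⟨B, hB, rfl⟩
    exact hB
  · refine sSup_le ?_
    rintro _ ⟨U, hU, rfl⟩
    exact pairFun_mono α β (le_sSup hU)

/-- The pairing of two frame homomorphisms, defined on the frame of opens of the product. -/
def pair [LocallyCompactSpace X] (α : FrameHom (Opens X) L) (β : FrameHom (Opens Y) L) :
    FrameHom (Opens (X × Y)) L where
  toFun := pairFun α β
  map_inf' := pairFun_inf α β
  map_top' := top_le_iff.1 <| by
    simpa using le_pairFun α β (U := ⊤) (V := ⊤) (W := ⊤) le_top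
  map_sSup' := pairFun_sSup α β

/-- Pulling back along a continuous map: the composite `T ∘ a⁻¹`. -/
def pull (T : FrameHom (Opens Z) L) (a : C(Z, X)) : FrameHom (Opens X) L := T.comp (Opens.comap a)

theorem pull_pull (T : FrameHom (Opens Z) L) (a : C(Z, X)) (b : C(X, Y)) :
    pull (pull T a) b = pull T (b.comp a) := rfl

theorem pull_apply (T : FrameHom (Opens Z) L) (a : C(Z, X)) (U : Opens X) :
    pull T a U = T (Opens.comap a U) := rfl

theorem pair_fst [LocallyCompactSpace X] (α : FrameHom (Opens X) L)
    (β : FrameHom (Opens Y) L) : pull (pair α β) ContinuousMap.fst = α := by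
  ext U
  apply le_antisymm
  · refine pairFun_le α β fun V W h => ?_
    rcases Set.eq_empty_or_nonempty (W : Set Y) with hW | ⟨y, hy⟩
    · have : W = ⊥ := Opens.ext hW
      simp [this]
    · refine inf_le_left.trans (OrderHomClass.mono α fun x hx => ?_)
      exact h (show (x, y) ∈ box V W from ⟨hx, hy⟩)
  · have := le_pairFun α β (U := Opens.comap ContinuousMap.fst U) (V := U) (W := ⊤)
      (fun p hp => hp.1)
    rw [map_top, inf_top_eq] at this
    exact this

theorem pair_snd [LocallyCompactSpace X] (α : FrameHom (Opens X) L)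
    (β : FrameHom (Opens Y) L) : pull (pair α β) ContinuousMap.snd = β := by
  ext U
  apply le_antisymm
  · refine pairFun_le α β fun V W h => ?_
    rcases Set.eq_empty_or_nonempty (V : Set X) with hV | ⟨x, hx⟩
    · have : V = ⊥ := Opens.ext hV
      simp [this]
    · refine inf_le_right.trans (OrderHomClass.mono β fun y hy => ?_)
      exact h (show (x, y) ∈ box V W from ⟨hx, hy⟩)
  · have := le_pairFun α β (U := Opens.comap ContinuousMap.snd U) (V := ⊤) (W := U)
      (fun p hp => hp.2)
    rw [map_top, top_inf_eq] at this
    exact this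

theorem pair_pull [LocallyCompactSpace X] (T : FrameHom (Opens Z) L) (a : C(Z, X))
    (b : C(Z, Y)) : pair (pull T a) (pull T b) = pull T (a.prodMk b) := by
  ext U
  apply le_antisymm
  · refine pairFun_le _ _ fun V W h => ?_
    rw [pull_apply, pull_apply, ← map_inf]
    exact OrderHomClass.mono T fun z hz => h (show (a z, b z) ∈ box V W from hz)
  · have hU : Opens.comap (a.prodMk b) U ≤ sSup {O | ∃ V W, box V W ≤ U ∧
        O = Opens.comap a V ⊓ Opens.comap b W} := by
      intro z hz
      obtain ⟨A, B, hA, hB, hAB⟩ := exists_box (show (a z, b z) ∈ U from hz)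
      exact Opens.mem_sSup.2 ⟨_, ⟨A, B, hAB, rfl⟩, hA, hB⟩
    refine (OrderHomClass.mono T hU).trans ?_
    rw [map_sSup]
    refine sSup_le ?_
    rintro _ ⟨_, ⟨V, W, h, rfl⟩, rfl⟩
    rw [map_inf]
    exact le_pairFun (pull T a) (pull T b) h

end Pairing

section Ring

variable {Z L : Type*} [TopologicalSpace Z] [Order.Frame L]

/-- The constant function `𝐫`. -/
def const (L : Type*) [Order.Frame L] (r : ℝ) : RL L where
  toFun U := ⨆ _ : r ∈ U, ⊤
  map_inf' U V := by
    by_cases hU : r ∈ U <;> by_cases hV : r ∈ V <;> simp [hU, hV]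
  map_top' := by simp
  map_sSup' S := by
    apply le_antisymm
    · refine iSup_le fun h => ?_
      obtain ⟨U, hU, hr⟩ := Opens.mem_sSup.1 h
      exact le_sSup_of_le ⟨U, hU, rfl⟩ (le_iSup_of_le hr le_rfl)
    · refine sSup_le ?_
      rintro _ ⟨U, hU, rfl⟩
      exact iSup_le fun hr => le_iSup_of_le (Opens.mem_sSup.2 ⟨U, hU, hr⟩) le_rfl

instance : Zero (RL L) := ⟨const L 0⟩
instance : One (RL L) := ⟨const L 1⟩

/-- `(α + β)(U)` is the join of all `α V ⊓ β W` with `V, W` open and `x + y ∈ U` for all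
`x ∈ V`, `y ∈ W`. -/
instance : Add (RL L) :=
  ⟨fun α β => pull (pair α β) (ContinuousMap.fst + ContinuousMap.snd)⟩

/-- `(α * β)(U)` is the join of all `α V ⊓ β W` with `V, W` open and `x * y ∈ U` for all
`x ∈ V`, `y ∈ W`. -/
instance : Mul (RL L) :=
  ⟨fun α β => pull (pair α β) (ContinuousMap.fst * ContinuousMap.snd)⟩

/-- `(-α)(U) = α(-U)`. -/
instance : Neg (RL L) := ⟨fun α => pull α (-ContinuousMap.id ℝ)⟩

theorem add_apply (α β : RL L) (U : Opens ℝ) : (α + β) U =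
    ⨆ (V : Opens ℝ) (W : Opens ℝ) (_ : ∀ x ∈ V, ∀ y ∈ W, x + y ∈ U), α V ⊓ β W := by
  refine iSup_congr fun V => iSup_congr fun W => iSup_congr_Prop ?_ fun _ => rfl
  exact ⟨fun h x hx y hy => h (show (x, y) ∈ box V W from ⟨hx, hy⟩), fun h p hp => h _ hp.1 _ hp.2⟩

theorem mul_apply (α β : RL L) (U : Opens ℝ) : (α * β) U =
    ⨆ (V : Opens ℝ) (W : Opens ℝ) (_ : ∀ x ∈ V, ∀ y ∈ W, x * y ∈ U), α V ⊓ β W := by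
  refine iSup_congr fun V => iSup_congr fun W => iSup_congr_Prop ?_ fun _ => rfl
  exact ⟨fun h x hx y hy => h (show (x, y) ∈ box V W from ⟨hx, hy⟩), fun h p hp => h _ hp.1 _ hp.2⟩

theorem pull_add (T : FrameHom (Opens Z) L) (a b : C(Z, ℝ)) :
    (pull T a + pull T b : RL L) = pull T (a + b) := by
  change pull (pair (pull T a) (pull T b)) _ = _
  rw [pair_pull]; rfl

theorem pull_mul (T : FrameHom (Opens Z) L) (a b : C(Z, ℝ)) :
    (pull T a * pull T b : RL L) = pull T (a * b) := by
  change pull (pair (pull T a) (pull T b)) _ = _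
  rw [pair_pull]; rfl

theorem pull_neg (T : FrameHom (Opens Z) L) (a : C(Z, ℝ)) :
    (-pull T a : RL L) = pull T (-a) := rfl

theorem pull_const (T : FrameHom (Opens Z) L) (r : ℝ) :
    (pull T (ContinuousMap.const Z r) : RL L) = const L r := by
  ext U
  change T _ = ⨆ _ : r ∈ U, ⊤
  by_cases hr : r ∈ U
  · have : Opens.comap (ContinuousMap.const Z r) U = ⊤ := by ext; simp [hr]
    simp [this, hr]
  · have : Opens.comap (ContinuousMap.const Z r) U = ⊥ := by ext; simp [hr]
    simp [this, hr]

theorem pull_zero (T : FrameHom (Opens Z) L) : (0 : RL L) = pull T 0 := (pull_const T 0).symm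

theorem pull_one (T : FrameHom (Opens Z) L) : (1 : RL L) = pull T 1 := (pull_const T 1).symm

/-- Any three elements are the images of three continuous functions on a common space. -/
theorem exists_rep (α β γ : RL L) : ∃ (T : FrameHom (Opens ((ℝ × ℝ) × ℝ)) L)
    (a b c : C((ℝ × ℝ) × ℝ, ℝ)), α = pull T a ∧ β = pull T b ∧ γ = pull T c := by
  refine ⟨pair (pair α β) γ, ContinuousMap.fst.comp ContinuousMap.fst,
    ContinuousMap.snd.comp ContinuousMap.fst, ContinuousMap.snd, ?_, ?_, ?_⟩
  · rw [← pull_pull, pair_fst, pair_fst]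
  · rw [← pull_pull, pair_fst, pair_snd]
  · rw [pair_snd]

/-- The ring of continuous real-valued functions on `L`. -/
instance : CommRing (RL L) where
  add_assoc α β γ := by
    obtain ⟨T, a, b, c, rfl, rfl, rfl⟩ := exists_rep α β γ
    simp only [pull_add, add_assoc]
  zero_add α := by
    obtain ⟨T, a, b, c, rfl, -, -⟩ := exists_rep α α α
    rw [pull_zero T, pull_add, zero_add]
  add_zero α := by
    obtain ⟨T, a, b, c, rfl, -, -⟩ := exists_rep α α α
    rw [pull_zero T, pull_add, add_zero]
  add_comm α β := by
    obtain ⟨T, a, b, c, rfl, rfl, -⟩ := exists_rep α β α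
    rw [pull_add, pull_add, add_comm]
  mul_assoc α β γ := by
    obtain ⟨T, a, b, c, rfl, rfl, rfl⟩ := exists_rep α β γ
    simp only [pull_mul, mul_assoc]
  mul_comm α β := by
    obtain ⟨T, a, b, c, rfl, rfl, -⟩ := exists_rep α β α
    rw [pull_mul, pull_mul, mul_comm]
  one_mul α := by
    obtain ⟨T, a, b, c, rfl, -, -⟩ := exists_rep α α α
    rw [pull_one T, pull_mul, one_mul]
  mul_one α := by
    obtain ⟨T, a, b, c, rfl, -, -⟩ := exists_rep α α α
    rw [pull_one T, pull_mul, mul_one]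
  zero_mul α := by
    obtain ⟨T, a, b, c, rfl, -, -⟩ := exists_rep α α α
    rw [pull_zero T, pull_mul, zero_mul]
  mul_zero α := by
    obtain ⟨T, a, b, c, rfl, -, -⟩ := exists_rep α α α
    rw [pull_zero T, pull_mul, mul_zero]
  left_distrib α β γ := by
    obtain ⟨T, a, b, c, rfl, rfl, rfl⟩ := exists_rep α β γ
    simp only [pull_mul, pull_add, mul_add]
  right_distrib α β γ := by
    obtain ⟨T, a, b, c, rfl, rfl, rfl⟩ := exists_rep α β γ
    simp only [pull_mul, pull_add, add_mul]
  neg_add_cancel α := by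
    obtain ⟨T, a, b, c, rfl, -, -⟩ := exists_rep α α α
    rw [pull_zero T, pull_neg, pull_add, neg_add_cancel]
  nsmul := nsmulRec
  zsmul := zsmulRec

end Ring

section Subsets

variable {L : Type*} [Order.Frame L]

/-- The cozero element `coz α = α(-,0) ∨ α(0,-)`. -/
def coz (α : RL L) : L := α (below 0) ⊔ α (above 0)

/-- The pointfree image `R_α = {r ∈ ℝ | coz (α - 𝐫) ≠ 1}`. -/
def image (α : RL L) : Set ℝ := {r | coz (α - const L r) ≠ ⊤}

/-- The elements of `RL L` with countable pointfree image. -/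
def Rc (L : Type*) [Order.Frame L] : Set (RL L) := {α | (image α).Countable}

/-- The bounded elements of `RL L`. -/
def bounded (L : Type*) [Order.Frame L] : Set (RL L) := {α | ∃ p q : ℝ, α (interval p q) = ⊤}

/-- The bounded part of `Rc L`. -/
def RcStar (L : Type*) [Order.Frame L] : Set (RL L) := Rc L ∩ bounded L

/-- For a complemented element `c` (with pseudocomplement `cᶜ`), the function `e_c` taking the
value `1` on `c` and `0` on `cᶜ`. -/
def idem (c : L) (hc : c ⊔ cᶜ = ⊤) : RL L where
  toFun U := (⨆ _ : (1 : ℝ) ∈ U, c) ⊔ (⨆ _ : (0 : ℝ) ∈ U, cᶜ)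
  map_inf' U V := by
    by_cases h1 : (1 : ℝ) ∈ U <;> by_cases h2 : (1 : ℝ) ∈ V <;>
    by_cases h3 : (0 : ℝ) ∈ U <;> by_cases h4 : (0 : ℝ) ∈ V <;> simp [h1, h2, h3, h4, hc]
  map_top' := by simp [hc]
  map_sSup' S := by
    apply le_antisymm
    · refine sup_le (iSup_le fun h => ?_) (iSup_le fun h => ?_)
      · obtain ⟨U, hU, hr⟩ := Opens.mem_sSup.1 h
        exact le_sSup_of_le ⟨U, hU, rfl⟩ (le_sup_of_le_left (le_iSup_of_le hr le_rfl))
      · obtain ⟨U, hU, hr⟩ := Opens.mem_sSup.1 h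
        exact le_sSup_of_le ⟨U, hU, rfl⟩ (le_sup_of_le_right (le_iSup_of_le hr le_rfl))
    · refine sSup_le ?_
      rintro _ ⟨U, hU, rfl⟩
      exact sup_le_sup
        (iSup_le fun hr => le_iSup_of_le (Opens.mem_sSup.2 ⟨U, hU, hr⟩) le_rfl)
        (iSup_le fun hr => le_iSup_of_le (Opens.mem_sSup.2 ⟨U, hU, hr⟩) le_rfl)

end Subsets

/-- A commutative ring is clean if each element is the sum of a unit and an idempotent. -/
def IsCleanRing (R : Type*) [CommRing R] : Prop :=
  ∀ a : R, ∃ u e : R, IsUnit u ∧ IsIdempotentElem e ∧ a = u + e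

/-- `u` is an invertible element of `S`, with its inverse again in `S`. -/
def IsUnitIn {R : Type*} [CommRing R] (S : Set R) (u : R) : Prop := u ∈ S ∧ ∃ v ∈ S, u * v = 1

/-- Each element of `S` is the sum of an element of `S` invertible in `S` and an idempotent
belonging to `S`. For (the underlying set of) a subring this is cleanness of the subring. -/
def IsCleanSet {R : Type*} [CommRing R] (S : Set R) : Prop :=
  ∀ a ∈ S, ∃ u e : R, IsUnitIn S u ∧ e ∈ S ∧ IsIdempotentElem e ∧ a = u + e

theorem isCleanSet_subring {R : Type*} [CommRing R] (S : Subring R) :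
    IsCleanSet (S : Set R) ↔ IsCleanRing S := by
  constructor
  · rintro h ⟨a, ha⟩
    obtain ⟨u, e, ⟨hu, v, hv, huv⟩, he, hee, rfl⟩ := h a ha
    exact ⟨⟨u, hu⟩, ⟨e, he⟩, IsUnit.of_mul_eq_one ⟨v, hv⟩ (Subtype.ext huv), Subtype.ext hee, rfl⟩
  · intro h a ha
    obtain ⟨u, e, hu, he, hae⟩ := h ⟨a, ha⟩
    obtain ⟨v, hv⟩ := hu.exists_right_inv
    exact ⟨u, e, ⟨u.2, v, v.2, congrArg Subtype.val hv⟩, e.2, congrArg Subtype.val he,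
      congrArg Subtype.val hae⟩

end PointfreeReal

end

open PointfreeReal

noncomputable section

namespace PointfreeReal

/-! ### Elements of `RL L` represented by continuous functions -/

section Pull

variable {Z L : Type*} [TopologicalSpace Z] [Order.Frame L]

/-! Since `(0, 1/2)` is uncountable, some `r` in it lies outside `R_α`
(`exists_coz_sub_const_eq_top`). Then `α` sends the line punctured at `r` to `⊤`, so it factors
through the opens of that subspace by some `T` (`restrict`, `pull_incl`). On the punctured line the
function equal to `1` left of `r` and `0` right of `r` is continuous, and its image under `T` is
`e_c` (`idem_eq_pull`).

Everything else is a pointwise check on the punctured line. There `x - step r x` is below `-r` or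
above `r` (`sub_step_bounds`), so it has a continuous inverse bounded by `r⁻¹`. Its pointfree image
lies in `R_α ∪ (R_α - 1)`, and that of the inverse lies in the set of inverses of the former, so
countability survives. -/

theorem pull_sub (T : FrameHom (Opens Z) L) (a b : C(Z, ℝ)) :
    (pull T a - pull T b : RL L) = pull T (a - b) := by
  rw [sub_eq_add_neg, pull_neg, pull_add, sub_eq_add_neg]

/-- The open set on which a continuous real function avoids the value `s`. -/
def neSet (a : C(Z, ℝ)) (s : ℝ) : Opens Z :=
  ⟨{z | a z ≠ s}, isOpen_ne_fun a.continuous continuous_const⟩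

/-- Reduces every question about pointfree images to inclusions between the open sets where a
function avoids a value. -/
theorem coz_pull_sub_const (T : FrameHom (Opens Z) L) (a : C(Z, ℝ)) (s : ℝ) :
    coz (pull T a - const L s) = T (neSet a s) := by
  rw [← pull_const T s, pull_sub, coz, pull_apply, pull_apply, ← map_sup]
  congr 1
  ext z
  change a z - s < 0 ∨ 0 < a z - s ↔ a z ≠ s
  rw [sub_neg, sub_pos, ne_iff_lt_or_gt]

theorem mem_image_pull (T : FrameHom (Opens Z) L) (a : C(Z, ℝ)) (s : ℝ) :
    s ∈ image (pull T a) ↔ T (neSet a s) ≠ ⊤ := by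
  rw [← coz_pull_sub_const]
  rfl

theorem pull_mem_bounded {T : FrameHom (Opens Z) L} {a : C(Z, ℝ)} {p q : ℝ} {U : Opens Z}
    (hU : T U = ⊤) (h : ∀ z ∈ U, p < a z ∧ a z < q) : pull T a ∈ bounded L := by
  refine ⟨p, q, top_le_iff.1 ?_⟩
  rw [pull_apply, ← hU]
  exact OrderHomClass.mono T fun z hz => h z hz

end Pull

/-! ### Factoring through an open subspace -/

section Restrict

variable {X L : Type*} [TopologicalSpace X] [Order.Frame L]

/-- A frame homomorphism which sends the open set `O` to the top factors through the opens
of `O`. -/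
def restrict (α : FrameHom (Opens X) L) (O : Opens X) (hO : α O = ⊤) :
    FrameHom (Opens O) L where
  toFun U := α ⟨Subtype.val '' (U : Set O), O.2.isOpenMap_subtype_val _ U.2⟩
  map_inf' U V := by
    rw [← map_inf]
    exact congrArg α (Opens.ext (Set.image_inter Subtype.val_injective))
  map_top' := by
    rw [← hO]
    exact congrArg α (Opens.ext (by simp))
  map_sSup' S := by
    have h : (⟨Subtype.val '' ((sSup S : Opens O) : Set O),
        O.2.isOpenMap_subtype_val _ (sSup S).2⟩ : Opens X) =
        ⨆ U ∈ S, ⟨Subtype.val '' (U : Set O), O.2.isOpenMap_subtype_val _ U.2⟩ := by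
      ext x
      simp only [Opens.coe_sSup, Opens.coe_iSup, Opens.coe_mk, Set.image_iUnion]
    rw [h, map_iSup₂, sSup_image]

theorem restrict_comap_val (α : FrameHom (Opens X) L) (O : Opens X) (hO : α O = ⊤)
    (U : Opens X) :
    restrict α O hO (Opens.comap ⟨Subtype.val, continuous_subtype_val⟩ U) = α U := by
  have h : α (O ⊓ U) = α U := by rw [map_inf, hO, top_inf_eq]
  rw [← h]
  exact congrArg α (Opens.ext (Subtype.image_preimage_coe _ _))

end Restrict

/-! ### The punctured line and the step function -/

section Step

variable {L : Type*} [Order.Frame L]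

/-- The complement of a point of the real line. -/
def punctured (r : ℝ) : Opens ℝ := below r ⊔ above r

theorem mem_punctured {r x : ℝ} : x ∈ punctured r ↔ x < r ∨ r < x := Iff.rfl

/-- The inclusion of a punctured line into the line. -/
def incl (r : ℝ) : C(punctured r, ℝ) := ⟨Subtype.val, continuous_subtype_val⟩

/-- With `r` removed, the left ray is both open and closed, so its frontier is empty. -/
theorem continuous_step (r : ℝ) :
    Continuous fun z : punctured r => if (z : ℝ) < r then (1 : ℝ) else 0 := by
  have hlt : IsOpen {z : punctured r | (z : ℝ) < r} :=
    isOpen_lt continuous_subtype_val continuous_const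
  have hle : {z : punctured r | (z : ℝ) < r} = {z : punctured r | (z : ℝ) ≤ r} := by
    ext z
    exact ⟨fun h => le_of_lt (α := ℝ) h, fun h => (mem_punctured.1 z.2).resolve_right (not_lt.2 h)⟩
  have hclosed : IsClosed {z : punctured r | (z : ℝ) < r} := by
    rw [hle]
    exact isClosed_le continuous_subtype_val continuous_const
  refine Continuous.if (fun z hz => ?_) continuous_const continuous_const
  have hclopen : IsClopen {z : punctured r | (z : ℝ) < r} := ⟨hclosed, hlt⟩
  rw [hclopen.frontier_eq] at hz
  exact hz.elim

/-- The function on the line punctured at `r` with value `1` to the left of `r` and `0` to the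
right. -/
def step (r : ℝ) : C(punctured r, ℝ) := ⟨_, continuous_step r⟩

theorem step_of_lt {r : ℝ} {z : punctured r} (h : (z : ℝ) < r) : step r z = 1 := if_pos h

theorem step_of_gt {r : ℝ} {z : punctured r} (h : r < (z : ℝ)) : step r z = 0 :=
  if_neg h.not_gt

/-- On the left, `x - 1 < r - 1 < -r`; the last inequality is exactly `r < 1 / 2`. -/
theorem sub_step_bounds {r : ℝ} (hr : r < 1 / 2) (z : punctured r) :
    (incl r - step r) z < -r ∨ r < (incl r - step r) z := by
  rcases z.2 with h | h
  · left
    rw [ContinuousMap.sub_apply, step_of_lt h]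
    have : (z : ℝ) < r := h
    change (z : ℝ) - 1 < -r
    linarith
  · right
    rw [ContinuousMap.sub_apply, step_of_gt h, sub_zero]
    exact h

theorem sub_step_ne_zero {r : ℝ} (h0 : 0 < r) (hr : r < 1 / 2) (z : punctured r) :
    (incl r - step r) z ≠ 0 := by
  rcases sub_step_bounds hr z with h | h
  · exact (h.trans (neg_lt_zero.2 h0)).ne
  · exact (h0.trans h).ne'

/-- The pointwise inverse of `x - step r x` for `0 < r < 1 / 2`. -/
def invSubStep {r : ℝ} (h0 : 0 < r) (hr : r < 1 / 2) : C(punctured r, ℝ) :=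
  ⟨fun z => ((incl r - step r) z)⁻¹,
    (incl r - step r).continuous.inv₀ (sub_step_ne_zero h0 hr)⟩

theorem map_punctured {α : RL L} {r : ℝ} (h : coz (α - const L r) = ⊤) :
    α (punctured r) = ⊤ := by
  have hα : pull α (ContinuousMap.id ℝ) = α := rfl
  rw [← hα, coz_pull_sub_const] at h
  rw [← h]
  congr 1
  ext x
  exact (ne_iff_lt_or_gt (a := x) (b := r)).symm

theorem compl_map_below {α : RL L} {r : ℝ} (h : α (punctured r) = ⊤) :
    (α (below r))ᶜ = α (above r) := by
  have hd : below r ⊓ above r = ⊥ := by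
    ext x
    exact ⟨fun hx => (lt_asymm (a := x) (b := r) hx.1 hx.2).elim, fun hx => hx.elim⟩
  refine IsCompl.compl_eq ⟨?_, ?_⟩
  · rw [disjoint_iff, ← map_inf, hd, map_bot]
  · rw [codisjoint_iff, ← map_sup]
    exact h

theorem pull_incl {α : RL L} {r : ℝ} (h : α (punctured r) = ⊤) :
    pull (restrict α _ h) (incl r) = α := by
  ext U
  exact restrict_comap_val α _ h U

/-- The preimage of `U` under the step function is the union of the left ray, if `1 ∈ U`, and the
right ray, if `0 ∈ U`; the pseudocomplement of `α (below r)` is the value of `α` on the right ray.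
-/
theorem idem_eq_pull {α : RL L} {r : ℝ} (h : α (punctured r) = ⊤)
    (hc : α (below r) ⊔ (α (below r))ᶜ = ⊤) :
    idem (α (below r)) hc = pull (restrict α _ h) (step r) := by
  ext U
  change (⨆ _ : (1 : ℝ) ∈ U, α (below r)) ⊔ (⨆ _ : (0 : ℝ) ∈ U, (α (below r))ᶜ) = _
  have key : Opens.comap (step r) U = (⨆ _ : (1 : ℝ) ∈ U, Opens.comap (incl r) (below r)) ⊔
      (⨆ _ : (0 : ℝ) ∈ U, Opens.comap (incl r) (above r)) := by
    ext z
    rcases z.2 with hz | hz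
    · have hz' : ¬ r < (z : ℝ) := not_lt.2 (le_of_lt hz)
      have hl : (z : ℝ) < r := hz
      simp [step_of_lt hz, incl, below, above, hl, hz']
    · have hz' : ¬ (z : ℝ) < r := not_lt.2 (le_of_lt hz)
      have hl : r < (z : ℝ) := hz
      simp [step_of_gt hz, incl, below, above, hl, hz']
  have hv (V : Opens ℝ) : restrict α _ h (Opens.comap (incl r) V) = α V :=
    restrict_comap_val α _ h V
  rw [pull_apply, key, compl_map_below h, map_sup, map_iSup, map_iSup, hv, hv]

end Step

/-! ### Countable image and boundedness of the functions involved -/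

section Membership

variable {L : Type*} [Order.Frame L] {r : ℝ} (T : FrameHom (Opens (punctured r)) L)

theorem pull_step_mem_RcStar : pull T (step r) ∈ RcStar L := by
  have hz : ∀ z, step r z = 1 ∨ step r z = 0 := fun z => z.2.imp step_of_lt step_of_gt
  constructor
  · refine Set.Countable.mono (fun s hs => ?_) ((Set.toFinite ({1, 0} : Set ℝ)).countable)
    rw [mem_image_pull] at hs
    contrapose! hs
    simp only [Set.mem_insert_iff, Set.mem_singleton_iff, not_or] at hs
    rw [← map_top T]
    congr 1
    ext z
    simp only [Opens.coe_top, Set.mem_univ, iff_true]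
    change step r z ≠ s
    rcases hz z with h | h <;> rw [h]
    exacts [Ne.symm hs.1, Ne.symm hs.2]
  · refine pull_mem_bounded (p := -1) (q := 2) (map_top T) fun z _ => ?_
    rcases hz z with h | h <;> rw [h] <;> norm_num

theorem pull_step_isIdempotentElem : IsIdempotentElem (pull T (step r) : RL L) := by
  rw [IsIdempotentElem, pull_mul]
  congr 1
  ext z
  rcases z.2 with h | h
  · simp [step_of_lt h]
  · simp [step_of_gt h]

/-- If `x - step r x = s`, then `x` is `s` or `s + 1`; so a value `s` with both `s` and `s + 1`
outside `R_α` is avoided. -/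
theorem pull_sub_step_mem_Rc (h : pull T (incl r) ∈ Rc L) :
    pull T (incl r - step r) ∈ Rc L := by
  have h1 : (image (pull T (incl r)) ∪ (fun s => s + 1) ⁻¹' image (pull T (incl r))).Countable :=
    Set.Countable.union h (Set.Countable.preimage_of_injOn h (add_left_injective 1).injOn)
  refine h1.mono fun s hs => ?_
  rw [Set.mem_union, Set.mem_preimage, mem_image_pull, mem_image_pull]
  rw [mem_image_pull] at hs
  by_contra! hcon
  refine hs (top_le_iff.1 ?_)
  -- The two copies of `⊤` become the values of `T` on the sets where `x ≠ s` and where `x ≠ s + 1`.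
  rw [← inf_idem (⊤ : L)]
  nth_rewrite 1 [← hcon.1]
  rw [← hcon.2, ← map_inf]
  refine OrderHomClass.mono T fun z hz => ?_
  change incl r z - step r z ≠ s
  rcases z.2 with h | h
  · rw [step_of_lt h]
    exact fun h' => hz.2 (sub_eq_iff_eq_add.1 h')
  · rw [step_of_gt h, sub_zero]
    exact hz.1

theorem pull_sub_step_mem_bounded (h : pull T (incl r) ∈ bounded L) :
    pull T (incl r - step r) ∈ bounded L := by
  obtain ⟨p, q, hpq⟩ := h
  -- The step function takes values in `{0, 1}`, so only the lower bound moves.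
  refine pull_mem_bounded (p := p - 1) (q := q) hpq fun z hz => ?_
  obtain ⟨h1, h2⟩ : p < incl r z ∧ incl r z < q := hz
  rw [ContinuousMap.sub_apply]
  rcases z.2 with h | h
  · rw [step_of_lt h]
    constructor <;> linarith
  · rw [step_of_gt h]
    constructor <;> linarith

theorem pull_invSubStep_mem_Rc (h0 : 0 < r) (hr : r < 1 / 2)
    (h : pull T (incl r - step r) ∈ Rc L) : pull T (invSubStep h0 hr) ∈ Rc L := by
  -- With `0⁻¹ = 0`, inversion is injective on all of `ℝ`, so `s = 0` needs no separate case.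
  refine (Set.Countable.preimage_of_injOn h (inv_injective (G := ℝ)).injOn).mono fun s hs => ?_
  rw [mem_image_pull] at hs
  rw [Set.mem_preimage, mem_image_pull]
  refine fun hcon => hs (top_le_iff.1 ?_)
  rw [← hcon]
  exact OrderHomClass.mono T fun z hz hz' => hz (inv_eq_iff_eq_inv.1 hz')

theorem pull_invSubStep_mem_bounded (h0 : 0 < r) (hr : r < 1 / 2) :
    pull T (invSubStep h0 hr) ∈ bounded L := by
  refine pull_mem_bounded (p := -r⁻¹) (q := r⁻¹) (map_top T) fun z _ => ?_
  rw [← abs_lt]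
  change |((incl r - step r) z)⁻¹| < r⁻¹
  rw [abs_inv]
  exact inv_strictAnti₀ h0 (lt_abs.2 ((sub_step_bounds hr z).symm.imp id lt_neg_of_lt_neg))

theorem pull_sub_step_mul_inv (h0 : 0 < r) (hr : r < 1 / 2) :
    (pull T (incl r - step r) * pull T (invSubStep h0 hr) : RL L) = 1 := by
  rw [pull_mul, pull_one T]
  congr 1
  ext z
  exact mul_inv_cancel₀ (sub_step_ne_zero h0 hr z)

end Membership

/-! ### Choice of `r` and the clean decomposition -/

variable {L : Type*} [Order.Frame L]

theorem exists_coz_sub_const_eq_top {α : RL L} (h : α ∈ Rc L) {a b : ℝ} (hab : a < b) :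
    ∃ r : ℝ, a < r ∧ r < b ∧ coz (α - const L r) = ⊤ := by
  by_contra! hcon
  exact (Cardinal.Real.Ioo_countable_iff.not.2 (not_le.2 hab))
    (h.mono fun r hr => hcon r hr.1 hr.2)

theorem sub_idem_isUnitIn {S : Set (RL L)} (hS : S = Rc L ∨ S = RcStar L) {α : RL L}
    (hα : α ∈ S) {r : ℝ} (h0 : 0 < r) (hr : r < 1 / 2) (hcoz : coz (α - const L r) = ⊤) :
    ∃ hc : α (below r) ⊔ (α (below r))ᶜ = ⊤,
      idem (α (below r)) hc ∈ S ∧ IsIdempotentElem (idem (α (below r)) hc) ∧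
      IsUnitIn S (α - idem (α (below r)) hc) := by
  have h := map_punctured hcoz
  have hc : α (below r) ⊔ (α (below r))ᶜ = ⊤ := by
    rw [compl_map_below h, ← map_sup]
    exact h
  have hsub : α - idem (α (below r)) hc = pull (restrict α _ h) (incl r - step r) := by
    rw [idem_eq_pull h, ← pull_sub, pull_incl]
  refine ⟨hc, ?_⟩
  rw [hsub, idem_eq_pull h]
  rw [← pull_incl h] at hα
  -- From here `α` enters only through `T`, and the claims are those already checked on the
  -- punctured line.
  generalize restrict α _ h = T at hα ⊢
  have hstep := pull_step_mem_RcStar T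
  have hinv := pull_sub_step_mul_inv T h0 hr
  rcases hS with rfl | rfl
  · have hu := pull_sub_step_mem_Rc T hα
    exact ⟨hstep.1, pull_step_isIdempotentElem T, hu, _, pull_invSubStep_mem_Rc T h0 hr hu, hinv⟩
  · have hu := pull_sub_step_mem_Rc T hα.1
    exact ⟨hstep, pull_step_isIdempotentElem T, ⟨hu, pull_sub_step_mem_bounded T hα.2⟩, _,
      ⟨pull_invSubStep_mem_Rc T h0 hr hu, pull_invSubStep_mem_bounded T h0 hr⟩, hinv⟩

theorem exists_coz_of_mem {S : Set (RL L)} (hS : S = Rc L ∨ S = RcStar L) {α : RL L}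
    (hα : α ∈ S) : ∃ r : ℝ, 0 < r ∧ r < 1 / 2 ∧ coz (α - const L r) = ⊤ := by
  refine exists_coz_sub_const_eq_top ?_ (by norm_num)
  rcases hS with rfl | rfl
  exacts [hα, hα.1]

theorem isCleanSet_of_eq {S : Set (RL L)} (hS : S = Rc L ∨ S = RcStar L) : IsCleanSet S := by
  intro α hα
  obtain ⟨r, h0, hr, hcoz⟩ := exists_coz_of_mem hS hα
  obtain ⟨hc, he, hi, hu⟩ := sub_idem_isUnitIn hS hα h0 hr hcoz
  exact ⟨_, _, hu, he, hi, (sub_add_cancel _ _).symm⟩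

end PointfreeReal

end

theorem theorem3p4 (L : Type*) [Order.Frame L] :
    IsCleanSet (Rc L) ∧ IsCleanSet (RcStar L) ∧
    (∀ S : Subring (RL L), (S : Set (RL L)) = Rc L ∨ (S : Set (RL L)) = RcStar L →
      IsCleanRing S) ∧
    ∀ S : Set (RL L), S = Rc L ∨ S = RcStar L →
      ∀ α ∈ S,
        (∃ r : ℝ, 0 < r ∧ r < 1 / 2 ∧ coz (α - const L r) = ⊤) ∧
        ∀ r : ℝ, 0 < r → r < 1 / 2 → coz (α - const L r) = ⊤ →
          ∃ hc : α (below r) ⊔ (α (below r))ᶜ = ⊤,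
            idem (α (below r)) hc ∈ S ∧
            IsIdempotentElem (idem (α (below r)) hc) ∧
            IsUnitIn S (α - idem (α (below r)) hc) := by
  exact ⟨isCleanSet_of_eq (.inl rfl), isCleanSet_of_eq (.inr rfl),
    fun S hS => (isCleanSet_subring S).1 (isCleanSet_of_eq hS),
    fun S hS α hα => ⟨exists_coz_of_mem hS hα,
      fun r h0 hr hcoz => sub_idem_isUnitIn hS hα h0 hr hcoz⟩⟩
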